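/- **Definitions.** An *effect algebra* is $(\mathcal E,0,1,\oplus)$ with $0\neq 1$ and a partial binary operation $\oplus$ (write $a\perp b$ if $a\oplus b$ is defined) such that: (E1) $a\perp b$ implies $b\perp a$ and $b\oplus a=a\oplus b$; (E2) if $a\perp b$ and $(a\oplus b)\perp c$, then $b\perp c$, $a\perp(b\oplus c)$ and $a\oplus(b\oplus c)=(a\oplus b)\oplus c$; (E3) for every $a$ there is a unique $a'$ with $a\perp a'$ and $a\oplus a'=1$; (E4) $a\perp 1$ implies $a=0$. Put $a\le b$ if $a\oplus c=b$ for some $c$. It is *convex* if it has a scalar multiplication $[0,1]\times\mathcal E\to\mathcal E$ with $\alpha(\beta a)=(\alpha\beta)a$; $\alpha a\perp\beta a$ and $(\alpha+\beta)a=\alpha a\oplus\beta a$ if $\alpha+\beta\le1$; $\lambda a\perp\lambda b$ and $\lambda(a\oplus b)=\lambda a\oplus\lambda b$ if $a\perp b$; and $1a=a$. A map $\phi$ of effect algebras is *additive* if $a\perp b$ implies $\phi(a)\perp\phi(b)$ and $\phi(a\oplus b)=\phi(a)\oplus\phi(b)$; it is a *morphism* if moreover $\phi(1)=1$, and an *isomorphism*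 if moreover it is surjective and $\phi(a)\perp\phi(b)$ implies $a\perp b$; it is *affine* if $\phi(\lambda a)=\lambda\phi(a)$. A *state* is a morphism into $[0,1]\subseteq\mathbb R$. A *convex sequential effect algebra* (convex SEA) is a convex effect algebra with a binary operation $\circ$ such that, writing $a|b$ for $a\circ b=b\circ a$: (S1) $b\mapsto a\circ b$ is additive; (S2) $1\circ a=a$; (S3) $a\circ b=0$ implies $a|b$; (S4) $a|b$ implies $a|b'$ and $a\circ(b\circ c)=(a\circ b)\circ c$ for all $c$; (S5) if $c|a$ and $c|b$, then $c|(a\circ b)$, and $c|(a\oplus b)$ whenever $a\perp b$; (S6) $(\lambda a)\circ b=a\circ(\lambda b)=\lambda(a\circ b)$ for $\lambda\in[0,1]$. A *SEA isomorphism* is an affine isomorphism that preserves the sequential products. An effect $a$ is *sharp* if the greatest lower bound of $a$ and $a'$ is $0$; a sharp $a\ne0$ is *one-dimensional* if every $b\le a$ is $\lambda a$ for some $\lambda\in[0,1]$. A *context* is a finite set $\mathcal A=\{a_1,\dots,a_n\}$ of one-dimensional sharp effects with $a_1\oplus\cdots\oplus a_n=1$. $\mathcal E$ is *finite-dimensional*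 if it has a context, and *spectral* if every $b\in\mathcal E$ is $\lambda_1a_1\oplus\cdots\oplus\lambda_na_n$ for some context $\{a_1,\dots,a_n\}$ and $\lambda_i\in[0,1]$. For each one-dimensional sharp $a$ fix a state $\widehat a$ with $\widehat a(a)=1$. For a context $\mathcal A$ let $\mathcal H(\mathcal A)=\{\sum_i\alpha_i\widehat a_i:\alpha_i\in\mathbb C\}$ be the complex Hilbert space with orthonormal basis $\widehat a_1,\dots,\widehat a_n$. The set of contexts is *complete* if there are unitary maps $U_{\mathcal A\mathcal B}\colon\mathcal H(\mathcal A)\to\mathcal H(\mathcal B)$, for all contexts $\mathcal A,\mathcal B$, such that $U_{\mathcal A\mathcal A}=I$, $U_{\mathcal A\mathcal B}=U_{\mathcal B\mathcal A}^*$, $|\langle U_{\mathcal A\mathcal B}\widehat a,U_{\mathcal C\mathcal B}\widehat c\rangle|^2=\widehat a(c)$ for all contexts $\mathcal A,\mathcal B,\mathcal C$ and $a\in\mathcal A$, $c\in\mathcal C$, and such that for every context $\mathcal B$ and every unit vector $\phi\in\mathcal H(\mathcal B)$ there are a context $\mathcal A$, an $a\in\mathcal A$ and a $z\in\mathbb C$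 with $|z|=1$ and $U_{\mathcal A\mathcal B}\widehat a=z\phi$. For a nonzero complex Hilbert space $H$, $\mathcal E(H)$ is the convex effect algebra of operators $A$ on $H$ with $0\le A\le I$, where $A\perp B$ means $A+B\le I$, and then $A\oplus B=A+B$. **Theorem 4.6.** Let $(\mathcal E,\circ)$ be a finite-dimensional spectral convex SEA whose set of contexts is complete with respect to states $\widehat a$ and unitary maps $U_{\mathcal A\mathcal B}$, and let $\mathcal B$ be a context. Then there is exactly one map $J\colon\mathcal E\to\mathcal E(\mathcal H(\mathcal B))$ such that $$J(b)=\sum_i\lambda_iP(U_{\mathcal A\mathcal B}\widehat a_i)\quad\text{whenever } b=\lambda_1a_1\oplus\cdots\oplus\lambda_na_n,\ \lambda_i\in[0,1],\ \mathcal A=\{a_1,\dots,a_n\}\text{ a context},$$ where $P(\phi)$ is the orthogonal projection onto $\mathbb C\phi$; this $J$ is an affine isomorphism. There is exactly one binary operation $\cdot$ on $\mathcal E(\mathcal H(\mathcal B))$ with $J(a)\cdot J(b)=J(a\circ b)$ for all $a,b\in\mathcal E$. With this product $\mathcal E(\mathcal H(\mathcal B))$ is a convex SEA, and $J$ is a SEA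 isomorphism from $(\mathcal E,\circ)$ to $(\mathcal E(\mathcal H(\mathcal B)),\cdot)$. -/

import Mathlib

noncomputable section

universe u v

/-- An effect algebra `(E, 0, 1, ⊕)`: `perp a b` says that `a ⊕ b` is defined, and `oplus a b h`
is its value. -/
class EffectAlgebra (E : Type u) where
  zero : E
  one : E
  zero_ne_one : zero ≠ one
  perp : E → E → Prop
  oplus : (a b : E) → perp a b → E
  oplus_comm : ∀ (a b : E) (h : perp a b), ∃ h' : perp b a, oplus b a h' = oplus a b h
  oplus_assoc : ∀ (a b c : E) (hab : perp a b) (h : perp (oplus a b hab) c),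
    ∃ (hbc : perp b c) (h' : perp a (oplus b c hbc)),
      oplus a (oplus b c hbc) h' = oplus (oplus a b hab) c h
  /-- The orthosupplement `a'`, the unique effect with `a ⊕ a' = 1`. -/
  compl : E → E
  oplus_compl : ∀ a : E, ∃ h : perp a (compl a), oplus a (compl a) h = one
  compl_unique : ∀ (a b : E) (h : perp a b), oplus a b h = one → b = compl a
  eq_zero_of_perp_one : ∀ a : E, perp a one → a = zero

/-- A convex effect algebra: an effect algebra with a multiplication by scalars in `[0,1]`. -/
class ConvexEffectAlgebra (E : Type u) extends EffectAlgebra E where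
  scale : unitInterval → E → E
  scale_scale : ∀ (α β : unitInterval) (a : E), scale α (scale β a) = scale (α * β) a
  scale_add : ∀ (α β γ : unitInterval) (a : E), (γ : ℝ) = (α : ℝ) + (β : ℝ) →
    ∃ h : perp (scale α a) (scale β a), scale γ a = oplus (scale α a) (scale β a) h
  scale_oplus : ∀ (r : unitInterval) (a b : E) (h : perp a b),
    ∃ h' : perp (scale r a) (scale r b),
      scale r (oplus a b h) = oplus (scale r a) (scale r b) h'
  scale_one : ∀ a : E, scale 1 a = a

namespace EffectAlgebra

section Basic

variable {E : Type u} [EffectAlgebra E]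

/-- The order `a ≤ b` of an effect algebra. -/
def Below (a b : E) : Prop := ∃ (c : E) (h : perp a c), oplus a c h = b

/-- `a` is sharp: the greatest lower bound of `a` and `a'` exists and is `0`. -/
def IsSharp (a : E) : Prop :=
  (Below zero a ∧ Below zero (compl a)) ∧
    ∀ x : E, Below x a → Below x (compl a) → Below x zero

/-- `IsOrthoSum f s x`: the orthogonal sum of the `f i`, `i ∈ s`, is defined and equals `x`. -/
inductive IsOrthoSum {ι : Type v} (f : ι → E) : Finset ι → E → Prop
  | empty : IsOrthoSum f ∅ zero
  | cons (i : ι) (s : Finset ι) (hi : i ∉ s) (x : E) (hx : IsOrthoSum f s x)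
      (h : perp (f i) x) : IsOrthoSum f (Finset.cons i s hi) (oplus (f i) x h)

end Basic

section Maps

variable {E : Type u} {F : Type v} [EffectAlgebra E] [EffectAlgebra F]

def IsAdditive (φ : E → F) : Prop :=
  ∀ (a b : E) (h : perp a b),
    ∃ h' : perp (φ a) (φ b), φ (oplus a b h) = oplus (φ a) (φ b) h'

def IsMorphism (φ : E → F) : Prop := IsAdditive φ ∧ φ one = one

def IsMonomorphism (φ : E → F) : Prop :=
  IsMorphism φ ∧ ∀ a b : E, perp (φ a) (φ b) → perp a b

def IsIsomorphism (φ : E → F) : Prop := IsMonomorphism φ ∧ Function.Surjective φ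

end Maps

end EffectAlgebra

open EffectAlgebra ConvexEffectAlgebra

/-- An isomorphism of convex effect algebras. -/
def IsAffineIsomorphism {E : Type u} {F : Type v} [ConvexEffectAlgebra E]
    [ConvexEffectAlgebra F] (φ : E → F) : Prop :=
  IsIsomorphism φ ∧ ∀ (r : unitInterval) (a : E), φ (scale r a) = scale r (φ a)

/-- `seq` is a sequential product on the convex effect algebra `E`, that is, `E` together with
`seq` is a convex sequential effect algebra. The relation `a | b` is `seq a b = seq b a`. -/
structure IsSequentialProduct {E : Type u} [ConvexEffectAlgebra E] (seq : E → E → E) : Prop where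
  additive : ∀ a : E, IsAdditive (seq a)
  one_seq : ∀ a : E, seq one a = a
  comm_of_eq_zero : ∀ a b : E, seq a b = zero → seq a b = seq b a
  comm_compl : ∀ a b : E, seq a b = seq b a → seq a (compl b) = seq (compl b) a
  assoc : ∀ a b : E, seq a b = seq b a → ∀ c : E, seq a (seq b c) = seq (seq a b) c
  comm_seq : ∀ a b c : E, seq c a = seq a c → seq c b = seq b c →
    seq c (seq a b) = seq (seq a b) c
  comm_oplus : ∀ a b c : E, seq c a = seq a c → seq c b = seq b c → ∀ h : perp a b,
    seq c (oplus a b h) = seq (oplus a b h) c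
  scale_seq : ∀ (r : unitInterval) (a b : E), seq (scale r a) b = scale r (seq a b)
  seq_scale : ∀ (r : unitInterval) (a b : E), seq a (scale r b) = scale r (seq a b)

/-- An isomorphism of convex sequential effect algebras with products `seq` and `seq'`. -/
def IsSEAIsomorphism {E : Type u} {F : Type v} [ConvexEffectAlgebra E] [ConvexEffectAlgebra F]
    (seq : E → E → E) (seq' : F → F → F) (φ : E → F) : Prop :=
  IsAffineIsomorphism φ ∧ ∀ a b : E, φ (seq a b) = seq' (φ a) (φ b)

/-- The effect algebra `[0,1] ⊆ ℝ`. -/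
instance unitIntervalEffectAlgebra : EffectAlgebra unitInterval where
  zero := 0
  one := 1
  zero_ne_one := zero_ne_one
  perp a b := (a : ℝ) + (b : ℝ) ≤ 1
  oplus a b h := ⟨(a : ℝ) + (b : ℝ), add_nonneg a.2.1 b.2.1, h⟩
  oplus_comm a b h := ⟨by linarith, Subtype.ext (add_comm _ _)⟩
  oplus_assoc a b c hab h := by
    have ha := a.2.1
    dsimp only at h
    exact ⟨by linarith, by dsimp only; linarith, Subtype.ext (add_assoc _ _ _).symm⟩
  compl a := ⟨1 - (a : ℝ), sub_nonneg.2 a.2.2, by linarith [a.2.1]⟩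
  oplus_compl a := ⟨by dsimp only; linarith, Subtype.ext (by simp)⟩
  compl_unique a b h hb := by
    have := congrArg Subtype.val hb
    apply Subtype.ext
    simp only [Set.Icc.coe_one] at this ⊢
    linarith
  eq_zero_of_perp_one a h := by
    have ha := a.2.1
    apply Subtype.ext
    simp only [Set.Icc.coe_one, Set.Icc.coe_zero] at h ⊢
    linarith

/-- A state is a morphism into `[0,1]`. -/
def IsState {E : Type u} [EffectAlgebra E] (ω : E → unitInterval) : Prop := IsMorphism ω

section Hilbert

variable (H : Type u) [NormedAddCommGroup H] [InnerProductSpace ℂ H]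

/-- The effects on `H`: the operators `A` with `0 ≤ A ≤ I`. -/
def HilbertEffect : Type u := {A : H →L[ℂ] H // 0 ≤ A ∧ A ≤ 1}

variable {H}

open scoped ComplexOrder in
theorem scale_mem_effects [CompleteSpace H] (r : unitInterval) {A : H →L[ℂ] H} (hA : 0 ≤ A ∧ A ≤ 1) :
    0 ≤ ((r : ℝ) : ℂ) • A ∧ ((r : ℝ) : ℂ) • A ≤ 1 := by
  have h0 : (0 : ℂ) ≤ ((r : ℝ) : ℂ) := by exact_mod_cast r.2.1
  have h1 : (0 : ℂ) ≤ ((1 - (r : ℝ) : ℝ) : ℂ) := by exact_mod_cast sub_nonneg.2 r.2.2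
  have hp : A.IsPositive := (ContinuousLinearMap.nonneg_iff_isPositive A).1 hA.1
  have e : ((1 - (r : ℝ) : ℝ) : ℂ) • A = A - ((r : ℝ) : ℂ) • A := by
    push_cast
    rw [sub_smul, one_smul]
  have h2 : 0 ≤ A - ((r : ℝ) : ℂ) • A := by
    rw [← e]
    exact (ContinuousLinearMap.nonneg_iff_isPositive _).2 (hp.smul_of_nonneg h1)
  exact ⟨(ContinuousLinearMap.nonneg_iff_isPositive _).2 (hp.smul_of_nonneg h0),
    (sub_nonneg.1 h2).trans hA.2⟩

/-- The Hilbertian effect algebra of a nonzero complex Hilbert space. -/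
instance hilbertConvexEffectAlgebra [CompleteSpace H] [Nontrivial H] :
    ConvexEffectAlgebra (HilbertEffect H) where
  zero := ⟨0, le_refl _, ContinuousLinearMap.nonneg_iff_isPositive _ |>.2
    ContinuousLinearMap.isPositive_one⟩
  one := ⟨1, ContinuousLinearMap.nonneg_iff_isPositive _ |>.2
    ContinuousLinearMap.isPositive_one, le_refl _⟩
  zero_ne_one h := zero_ne_one (congrArg Subtype.val h)
  perp A B := A.1 + B.1 ≤ 1
  oplus A B h := ⟨A.1 + B.1, add_nonneg A.2.1 B.2.1, h⟩
  oplus_comm A B h := ⟨by rwa [add_comm], Subtype.ext (add_comm _ _)⟩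
  oplus_assoc A B C hab h := by
    have h' : A.1 + (B.1 + C.1) ≤ 1 := by rw [← add_assoc]; exact h
    exact ⟨(le_add_of_nonneg_left A.2.1).trans h', h', Subtype.ext (add_assoc _ _ _).symm⟩
  compl A := ⟨1 - A.1, sub_nonneg.2 A.2.2, sub_le_self _ A.2.1⟩
  oplus_compl A := ⟨(add_sub_cancel A.1 1).le, Subtype.ext (add_sub_cancel A.1 1)⟩
  compl_unique A B h hB := Subtype.ext (eq_sub_of_add_eq' (congrArg Subtype.val hB))
  eq_zero_of_perp_one A h :=
    Subtype.ext (le_antisymm (nonpos_of_add_le_left h) A.2.1)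
  scale r A := ⟨((r : ℝ) : ℂ) • A.1, scale_mem_effects r A.2⟩
  scale_scale α β A := Subtype.ext (by
    change ((α : ℝ) : ℂ) • ((β : ℝ) : ℂ) • A.1 = (((α : ℝ) * (β : ℝ) : ℝ) : ℂ) • A.1
    rw [smul_smul, Complex.ofReal_mul])
  scale_add α β γ A h := by
    have e : ((α : ℝ) : ℂ) • A.1 + ((β : ℝ) : ℂ) • A.1 = ((γ : ℝ) : ℂ) • A.1 := by
      rw [h, ← add_smul]
      push_cast
      rfl
    exact ⟨e.le.trans (scale_mem_effects γ A.2).2, Subtype.ext e.symm⟩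
  scale_oplus r A B h :=
    ⟨(smul_add _ _ _).ge.trans (scale_mem_effects r ⟨add_nonneg A.2.1 B.2.1, h⟩).2,
      Subtype.ext (smul_add _ _ _)⟩
  scale_one A := Subtype.ext (by simp)

end Hilbert

section Contexts

variable {E : Type u} [ConvexEffectAlgebra E]

/-- `a` is a one-dimensional sharp effect. -/
def IsOneDimensional (a : E) : Prop :=
  IsSharp a ∧ a ≠ zero ∧ ∀ b : E, Below b a → ∃ r : unitInterval, b = scale r a

variable (E) in
/-- A context: a finite set of one-dimensional sharp effects with orthogonal sum `1`. -/
structure Context where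
  carrier : Finset E
  oneDimensional : ∀ a ∈ carrier, IsOneDimensional a
  sum_eq_one : IsOrthoSum (fun a : E => a) carrier one

/-- `b` is the orthogonal sum of the effects `r a • a`, where `a` runs over the context `A`. -/
def IsSpectralDecomposition (A : Context E) (r : E → unitInterval) (b : E) : Prop :=
  IsOrthoSum (fun a : E => scale (r a) a) A.carrier b

variable (E) in
def IsSpectral : Prop :=
  ∀ b : E, ∃ (A : Context E) (r : E → unitInterval), IsSpectralDecomposition A r b

/-- The state space of the context `A`: the complex Hilbert space of the formal combinations
`∑ α_a â`, `a ∈ A`, in which the `â` are an orthonormal basis. (As functionals, the states `â` are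
linearly independent because `â(c) = δ_ac` for `a, c ∈ A`.) -/
abbrev StateSpace (A : Context E) : Type u := EuclideanSpace ℂ {a : E // a ∈ A.carrier}

open Classical in
/-- The basis vector `â` of the state space of the context `A`. -/
def stateVector (A : Context E) (a : {a : E // a ∈ A.carrier}) : StateSpace A :=
  EuclideanSpace.single a 1

theorem Context.nonempty (A : Context E) : Nonempty {a : E // a ∈ A.carrier} := by
  have key : ∀ (s : Finset E) (x : E), IsOrthoSum (fun a : E => a) s x → x ≠ zero →
      s.Nonempty := by
    intro s x h hx
    cases h with
    | empty => exact absurd rfl hx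
    | cons i s hi y hy h => exact ⟨i, Finset.mem_cons_self i s⟩
  obtain ⟨a, ha⟩ := key _ _ A.sum_eq_one EffectAlgebra.zero_ne_one.symm
  exact ⟨⟨a, ha⟩⟩

instance stateSpaceNontrivial (A : Context E) : Nontrivial (StateSpace A) := by
  have := A.nonempty
  infer_instance

/-- A choice of a state `â` with `â(a) = 1` for each one-dimensional sharp effect `a`
(`hat a` is irrelevant for the other effects `a`). -/
def IsStateChoice (hat : E → E → unitInterval) : Prop :=
  ∀ a : E, IsOneDimensional a → IsState (hat a) ∧ hat a a = 1

/-- The unitary maps `U A B` make the set of all contexts comparable. -/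
structure IsComparison (hat : E → E → unitInterval)
    (U : (A B : Context E) → StateSpace A ≃ₗᵢ[ℂ] StateSpace B) : Prop where
  self : ∀ A : Context E, U A A = LinearIsometryEquiv.refl ℂ (StateSpace A)
  /-- `U A B` is the adjoint, equivalently the inverse, of `U B A`. -/
  symm : ∀ A B : Context E, U A B = (U B A).symm
  transition : ∀ (A B C : Context E) (a : {a : E // a ∈ A.carrier})
    (c : {c : E // c ∈ C.carrier}),
    ‖inner ℂ (U A B (stateVector A a)) (U C B (stateVector C c))‖ ^ 2
      = ((hat a.1 c.1 : unitInterval) : ℝ)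

/-- The unitary maps `U A B` make the set of all contexts complete: they make it comparable, and
each unit vector of a state space is, up to a phase, the image of some `â`. -/
structure IsCompleteComparison (hat : E → E → unitInterval)
    (U : (A B : Context E) → StateSpace A ≃ₗᵢ[ℂ] StateSpace B) : Prop
    extends IsComparison hat U where
  complete : ∀ (B : Context E) (φ : StateSpace B), ‖φ‖ = 1 →
    ∃ (A : Context E) (a : {a : E // a ∈ A.carrier}) (z : ℂ),
      ‖z‖ = 1 ∧ U A B (stateVector A a) = z • φ

/-- `J` is the map with `J(b) = ∑ r_a P(U_AB â)` whenever `b = ∑ r_a a` over a context `A`, where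
`P(φ)` is the projection onto the line spanned by `φ`. -/
def IsHilbertRepresentation (U : (A B : Context E) → StateSpace A ≃ₗᵢ[ℂ] StateSpace B)
    (B : Context E) (J : E → HilbertEffect (StateSpace B)) : Prop :=
  ∀ (A : Context E) (r : E → unitInterval) (b : E), IsSpectralDecomposition A r b →
    (J b).1 = ∑ a : {a : E // a ∈ A.carrier},
      (((r a.1 : unitInterval) : ℝ) : ℂ) •
        (Submodule.span ℂ {U A B (stateVector A a)}).starProjection

end Contexts

end

open EffectAlgebra ConvexEffectAlgebra
universe u v

noncomputable section

/-! By completeness every unit vector `φ` of the state space of `B` is, up to a phase, some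
transported basis vector, so it carries a state `ω`. For `b = ⊕ r_a a` over a context, the
transition rule shows that the operator `∑ r_a P(U_AB â)` has expectation `ω b` at `φ`. This number
does not depend on the decomposition, and over ℂ an operator is determined by its expectations at
unit vectors. Hence `J` is well defined (`contextOperator_eq`), and it is additive, affine and
unital because every `ω` is.

The delicate point is that `J` reflects orthogonality (`IsHilbertRepresentation.perp_of_perp`). The
effect `c = a/2 ⊕ b/2` always exists; if `J a + J b ≤ 1`, its spectral coefficients, being
expectations, are at most `1/2`, so `c ⊕ c` is defined, and regrouping the halves gives `a ⊥ b`.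
Surjectivity follows from the spectral theorem, since preimages of the rank-one terms can then be
added. The product is finally carried over along the bijection `J`. -/

namespace EffectAlgebra

/-! ### Partial sums as a total commutative monoid -/

/-- The set `E` with an element adjoined, which serves as the value of the undefined sums. -/
inductive Totalization (E : Type u) : Type u
  | undefined : Totalization E
  | defined (a : E) : Totalization E

/-- The inclusion of `E` into its totalization. -/
def tot {E : Type u} (a : E) : Totalization E := .defined a

theorem tot_injective {E : Type u} : Function.Injective (tot : E → Totalization E) :=
  fun _ _ h => Totalization.defined.inj h

theorem Totalization.ext {E : Type u} {x y : Totalization E}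
    (h : ∀ c : E, x = tot c ↔ y = tot c) : x = y := by
  cases x with
  | defined a => exact ((h a).1 rfl).symm
  | undefined =>
    cases y with
    | defined b => exact (h b).2 rfl
    | undefined => rfl

section Totalization

variable {E : Type u} [EffectAlgebra E]

theorem perp_symm {a b : E} (h : perp a b) : perp b a := (oplus_comm a b h).1

theorem compl_one : compl (one : E) = zero :=
  eq_zero_of_perp_one _ (perp_symm (oplus_compl one).1)

theorem compl_compl (a : E) : compl (compl a) = a := by
  obtain ⟨h, e⟩ := oplus_compl a
  obtain ⟨h', e'⟩ := oplus_comm _ _ h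
  exact (compl_unique _ _ h' (e'.trans e)).symm

/-- Neutrality of zero is not an axiom. Associativity applied to `(a' ⊕ a) ⊕ 0 = 1 ⊕ 0 = 1` shows
that `a ⊕ 0` is the orthosupplement of `a'`, which is `a`. -/
theorem oplus_zero (a : E) : ∃ h : perp a zero, oplus a zero h = a := by
  obtain ⟨h, e⟩ := oplus_compl (compl a)
  rw [compl_compl] at h
  have e₁ : oplus (compl a) a h = one := by
    obtain ⟨h', e'⟩ := oplus_compl (compl a)
    simpa only [compl_compl] using e'
  obtain ⟨h₁, e₂⟩ := oplus_compl (one : E)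
  rw [compl_one] at h₁
  have e₃ : oplus one zero h₁ = (one : E) := by simpa only [compl_one] using e₂
  have h₂ : perp (oplus (compl a) a h) zero := by rw [e₁]; exact h₁
  obtain ⟨h₃, h₄, e₄⟩ := oplus_assoc _ _ _ h h₂
  refine ⟨h₃, ?_⟩
  have e₅ : oplus (oplus (compl a) a h) zero h₂ = one := by
    rw [← e₃]; congr 1
  rw [compl_unique _ _ h₄ (e₄.trans e₅), compl_compl]

open Classical in
/-- The sum of the totalization. -/
def totAdd (x y : Totalization E) : Totalization E :=
  if h : ∃ (a b c : E) (h : perp a b), x = tot a ∧ y = tot b ∧ oplus a b h = c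
  then tot h.choose_spec.choose_spec.choose else .undefined

theorem totAdd_eq_tot_iff {x y : Totalization E} {c : E} :
    totAdd x y = tot c ↔
      ∃ (a b : E) (h : perp a b), x = tot a ∧ y = tot b ∧ oplus a b h = c := by
  by_cases h : ∃ (a b c : E) (h : perp a b), x = tot a ∧ y = tot b ∧ oplus a b h = c
  · rw [totAdd, dif_pos h, tot_injective.eq_iff]
    obtain ⟨hab, e₁, e₂, e⟩ := h.choose_spec.choose_spec.choose_spec
    constructor
    · rintro rfl
      exact ⟨_, _, hab, e₁, e₂, e⟩
    · rintro ⟨p, q, hpq, e₁', e₂', rfl⟩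
      rw [← e]
      congr 1
      · exact tot_injective (e₁.symm.trans e₁')
      · exact tot_injective (e₂.symm.trans e₂')
  · rw [totAdd, dif_neg h]
    constructor
    · intro e
      cases e
    · rintro ⟨a, b, hab, e₁, e₂, e⟩
      exact absurd ⟨a, b, c, hab, e₁, e₂, e⟩ h

theorem totAdd_comm (x y : Totalization E) : totAdd x y = totAdd y x := by
  refine Totalization.ext fun c => ?_
  simp only [totAdd_eq_tot_iff]
  constructor <;>
  · rintro ⟨a, b, h, rfl, rfl, rfl⟩
    obtain ⟨h', e⟩ := oplus_comm a b h
    exact ⟨b, a, h', rfl, rfl, e⟩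

theorem totAdd_assoc_of_eq_tot {x y z : Totalization E} {c : E}
    (h : totAdd (totAdd x y) z = tot c) : totAdd x (totAdd y z) = tot c := by
  obtain ⟨a, b, hab, e, rfl, rfl⟩ := totAdd_eq_tot_iff.1 h
  obtain ⟨p, q, hpq, rfl, rfl, rfl⟩ := totAdd_eq_tot_iff.1 e
  obtain ⟨h₁, h₂, e'⟩ := oplus_assoc _ _ _ hpq hab
  exact totAdd_eq_tot_iff.2 ⟨_, _, h₂, rfl, totAdd_eq_tot_iff.2 ⟨_, _, h₁, rfl, rfl, rfl⟩, e'⟩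

theorem tot_zero_totAdd (x : Totalization E) : totAdd (tot zero) x = x := by
  rw [totAdd_comm]
  refine Totalization.ext fun c => ?_
  rw [totAdd_eq_tot_iff]
  constructor
  · rintro ⟨a, b, h, rfl, e, rfl⟩
    cases tot_injective e
    rw [(oplus_zero a).2]
  · rintro rfl
    obtain ⟨h, e⟩ := oplus_zero c
    exact ⟨_, _, h, rfl, rfl, e⟩

instance : Zero (Totalization E) := ⟨tot zero⟩

instance : Add (Totalization E) := ⟨totAdd⟩

instance totalizationAddCommMonoid : AddCommMonoid (Totalization E) where
  add_assoc x y z := by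
    change totAdd (totAdd x y) z = totAdd x (totAdd y z)
    refine Totalization.ext fun c => ⟨totAdd_assoc_of_eq_tot, fun h => ?_⟩
    -- Axiom (E2) regroups in one direction only; commutativity turns the other direction into the
    -- same statement.
    rw [totAdd_comm, totAdd_comm x y]
    apply totAdd_assoc_of_eq_tot
    rw [totAdd_comm, totAdd_comm z y]
    exact h
  zero_add := tot_zero_totAdd
  add_zero x := (totAdd_comm _ _).trans (tot_zero_totAdd x)
  add_comm := totAdd_comm
  nsmul := nsmulRec

theorem tot_zero : tot (zero : E) = 0 := rfl

/-- In particular, a part of a sum with a defined value is itself defined. This is how orthogonality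
is obtained below. -/
theorem add_eq_tot_iff {x y : Totalization E} {c : E} :
    x + y = tot c ↔ ∃ (a b : E) (h : perp a b), x = tot a ∧ y = tot b ∧ oplus a b h = c :=
  totAdd_eq_tot_iff

theorem tot_add {a b : E} (h : perp a b) : tot a + tot b = tot (oplus a b h) :=
  add_eq_tot_iff.2 ⟨a, b, h, rfl, rfl, rfl⟩

theorem tot_add_eq_tot {a b c : E} : tot a + tot b = tot c ↔ ∃ h : perp a b, oplus a b h = c := by
  rw [add_eq_tot_iff]
  constructor
  · rintro ⟨p, q, h, e₁, e₂, e⟩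
    cases tot_injective e₁
    cases tot_injective e₂
    exact ⟨h, e⟩
  · rintro ⟨h, e⟩
    exact ⟨a, b, h, rfl, rfl, e⟩

/-- Makes the `Finset.sum` calculus available for orthogonal sums, so reordering and regrouping need
no definedness bookkeeping. -/
theorem isOrthoSum_iff {ι : Type v} {f : ι → E} {s : Finset ι} {x : E} :
    IsOrthoSum f s x ↔ ∑ i ∈ s, tot (f i) = tot x := by
  classical
  constructor
  · intro h
    induction h with
    | empty => rfl
    | cons i s hi x hx h ih => rw [Finset.sum_cons, ih, tot_add]
  · induction s using Finset.cons_induction generalizing x with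
    | empty =>
      intro h
      cases tot_injective (h : tot zero = tot x)
      exact IsOrthoSum.empty
    | cons i s hi ih =>
      intro h
      rw [Finset.sum_cons] at h
      obtain ⟨a, b, hab, e₁, e₂, rfl⟩ := add_eq_tot_iff.1 h
      cases tot_injective e₁
      exact IsOrthoSum.cons i s hi b (ih e₂) hab

theorem tot_compl (a : E) : tot a + tot (compl a) = tot one :=
  tot_add_eq_tot.2 (oplus_compl a)

end Totalization

/-! ### Scalars, halves and orthogonality -/

section Scale

variable {E : Type u} [ConvexEffectAlgebra E]

theorem tot_scale_add (α β γ : unitInterval) (a : E) (h : (γ : ℝ) = α + β) :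
    tot (scale α a) + tot (scale β a) = tot (scale γ a) := by
  obtain ⟨h', e⟩ := scale_add α β γ a h
  rw [e, tot_add]

theorem tot_scale_oplus (r : unitInterval) {a b c : E} (h : tot a + tot b = tot c) :
    tot (scale r a) + tot (scale r b) = tot (scale r c) := by
  obtain ⟨hab, rfl⟩ := tot_add_eq_tot.1 h
  obtain ⟨h', e⟩ := scale_oplus r a b hab
  rw [e, tot_add]

/-- Adding `(1a)'` to `0a ⊕ 1a = 1a` gives `0a ⊥ 1`, and (E4) applies. -/
theorem scale_zero (a : E) : scale 0 a = zero := by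
  have h := tot_scale_add 0 1 1 a (by simp)
  have hone : tot (scale 0 a) + tot one = tot one := by
    rw [← tot_compl (scale 1 a), ← add_assoc, h]
  exact eq_zero_of_perp_one _ (tot_add_eq_tot.1 hone).1

/-- The number one half as an element of the unit interval. -/
def half : unitInterval := ⟨1 / 2, by norm_num, by norm_num⟩

theorem tot_half_add_half (a : E) : tot (scale half a) + tot (scale half a) = tot a := by
  rw [tot_scale_add half half 1 a (by simp [half]; norm_num), scale_one]

/-- The four effects `a/2`, `a'/2`, `b/2`, `b'/2` sum to `1/2 ⊕ 1/2 = 1`, so each partial sum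
exists. -/
theorem perp_half (a b : E) : perp (scale half a) (scale half b) := by
  have h : (tot (scale half a) + tot (scale half b)) +
      (tot (scale half (compl a)) + tot (scale half (compl b))) = tot one := by
    rw [add_add_add_comm, tot_scale_oplus half (tot_compl a), tot_scale_oplus half (tot_compl b),
      tot_half_add_half]
  obtain ⟨x, y, -, e, -, -⟩ := add_eq_tot_iff.1 h
  exact (tot_add_eq_tot.1 e).1

/-- Two effects are orthogonal as soon as twice the sum of their halves is defined. -/
theorem perp_of_perp_half {a b : E}
    (h : perp (oplus _ _ (perp_half a b)) (oplus _ _ (perp_half a b))) : perp a b := by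
  have e := tot_add h
  -- Regrouping: `(a/2 + b/2) + (a/2 + b/2) = a + b`.
  rw [← tot_add, add_add_add_comm, tot_half_add_half, tot_half_add_half] at e
  exact (tot_add_eq_tot.1 e).1

/-- The remainders `(1 - 2 r_a) a` complete `c + c` to the sum of the context, which is `1`; hence
`c + c` is defined. -/
theorem perp_self_of_le_half {A : Context E} {r : E → unitInterval} {c : E}
    (hc : IsSpectralDecomposition A r c) (hr : ∀ a ∈ A.carrier, (r a : ℝ) ≤ 1 / 2) :
    perp c c := by
  have hc' := isOrthoSum_iff.1 hc
  have h1 := isOrthoSum_iff.1 A.sum_eq_one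
  have key : ∀ a ∈ A.carrier, ∃ x : Totalization E,
      tot (scale (r a) a) + tot (scale (r a) a) + x = tot a := by
    intro a ha
    have := hr a ha
    have h0 := (r a).2.1
    refine ⟨tot (scale ⟨1 - 2 * r a, by linarith, by linarith⟩ a), ?_⟩
    rw [tot_scale_add (r a) (r a) ⟨2 * r a, by linarith, by linarith⟩ a (two_mul _),
      tot_scale_add _ _ 1 a (by simp), scale_one]
  choose! x hx using key
  have e : (tot c + tot c) + ∑ a ∈ A.carrier, x a = tot one := by
    rw [← hc', ← Finset.sum_add_distrib, ← Finset.sum_add_distrib, Finset.sum_congr rfl hx, h1]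
  obtain ⟨y, z, -, e', -, -⟩ := add_eq_tot_iff.1 e
  exact (tot_add_eq_tot.1 e').1

open Classical in
theorem isSpectralDecomposition_single (A : Context E) {a : E} (ha : a ∈ A.carrier) :
    IsSpectralDecomposition A (fun x => if x = a then 1 else 0) a := by
  refine isOrthoSum_iff.2 ?_
  rw [Finset.sum_eq_single_of_mem a ha]
  · simp [scale_one]
  · intro b _ hb
    simp [hb, scale_zero, tot_zero]

end Scale

/-! ### States are automatically affine -/

section States

variable {E : Type u}

theorem IsState.apply_oplus [EffectAlgebra E] {ω : E → unitInterval} (hω : IsState ω) {a b : E}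
    (h : perp a b) : (ω (oplus a b h) : ℝ) = ω a + ω b := by
  obtain ⟨h', e⟩ := hω.1 a b h
  rw [e]; rfl

theorem IsState.apply_orthoSum [EffectAlgebra E] {ω : E → unitInterval} (hω : IsState ω)
    {ι : Type v} {f : ι → E} {s : Finset ι} {x : E} (h : IsOrthoSum f s x) :
    (ω x : ℝ) = ∑ i ∈ s, (ω (f i) : ℝ) := by
  induction h with
  | empty =>
    obtain ⟨h, e⟩ := oplus_zero (zero : E)
    have := hω.apply_oplus h
    rw [e] at this
    rw [Finset.sum_empty]
    linarith
  | cons i s hi x hx h ih => rw [Finset.sum_cons, hω.apply_oplus, ih]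

/-- Additivity settles rational arguments, and positivity makes `g` monotone, so a real argument is
squeezed between neighbouring fractions `m/n` and `(m+1)/n`. -/
theorem monotone_additive_linear (g : ℝ → ℝ) (h0 : ∀ x, 0 ≤ x → x ≤ 1 → 0 ≤ g x)
    (hadd : ∀ x y, 0 ≤ x → 0 ≤ y → x + y ≤ 1 → g (x + y) = g x + g y) {x : ℝ} (hx : 0 ≤ x)
    (hx1 : x ≤ 1) : g x = x * g 1 := by
  have hmono : ∀ x y, 0 ≤ x → x ≤ y → y ≤ 1 → g x ≤ g y := by
    intro x y hx hxy hy
    have := hadd x (y - x) hx (by linarith) (by linarith)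
    rw [add_sub_cancel] at this
    linarith [h0 (y - x) (by linarith) (by linarith)]
  have hmul : ∀ (n : ℕ) (x : ℝ), 0 ≤ x → n * x ≤ 1 → g (n * x) = n * g x := by
    intro n
    induction n with
    | zero =>
      intro x _ _
      have := hadd 0 0 le_rfl le_rfl (by norm_num)
      rw [add_zero] at this
      simp only [Nat.cast_zero, zero_mul]
      linarith
    | succ n ih =>
      intro x hx h
      push_cast at h ⊢
      have hn : 0 ≤ (n : ℝ) * x := by positivity
      rw [add_mul, one_mul] at h ⊢
      rw [hadd _ _ hn hx h, ih x hx (by linarith)]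
      ring
  have hg1 : 0 ≤ g 1 := h0 1 zero_le_one le_rfl
  have hfrac : ∀ m n : ℕ, 0 < n → m ≤ n → g (m / n) = m / n * g 1 := by
    intro m n hn hmn
    have hn' : (0 : ℝ) < n := by exact_mod_cast hn
    have hmn' : (m : ℝ) ≤ n := by exact_mod_cast hmn
    have e1 := hmul n (1 / n) (by positivity) (by rw [mul_one_div_cancel hn'.ne'])
    rw [mul_one_div_cancel hn'.ne'] at e1
    have e2 := hmul m (1 / n) (by positivity) (by rw [mul_one_div]; exact (div_le_one hn').2 hmn')
    rw [mul_one_div] at e2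
    rw [e2, e1]
    field_simp
  have hbound : ∀ n : ℕ, 0 < n → |g x - x * g 1| ≤ g 1 / n := by
    intro n hn
    have hn' : (0 : ℝ) < n := by exact_mod_cast hn
    -- At `x = 1` the upper fraction `(m+1)/n` would leave the interval.
    rcases hx1.lt_or_eq with hlt | rfl
    · set m := ⌊x * n⌋₊
      have hm1 : (m : ℝ) ≤ x * n := Nat.floor_le (by positivity)
      have hm2 : x * n < m + 1 := Nat.lt_floor_add_one _
      have hmn : m + 1 ≤ n := by
        have : (m : ℝ) < n := hm1.trans_lt (by nlinarith)
        exact_mod_cast this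
      have l1 : (m : ℝ) / n ≤ x := (div_le_iff₀ hn').2 hm1
      have l2 : x ≤ ((m + 1 : ℕ) : ℝ) / n := (le_div_iff₀ hn').2 (by push_cast; exact hm2.le)
      have b1 := hmono _ _ (by positivity) l1 hx1
      have b2 := hmono _ _ hx l2 ((div_le_one hn').2 (by exact_mod_cast hmn))
      rw [hfrac m n hn (by omega)] at b1
      rw [hfrac (m + 1) n hn hmn] at b2
      have c1 := mul_le_mul_of_nonneg_right l1 hg1
      have c2 := mul_le_mul_of_nonneg_right l2 hg1
      have e : ((m + 1 : ℕ) : ℝ) / n * g 1 = m / n * g 1 + g 1 / n := by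
        push_cast; ring
      rw [e] at b2 c2
      rw [abs_le]
      constructor <;> linarith
    · simp only [one_mul, sub_self, abs_zero]
      positivity
  have hz : |g x - x * g 1| ≤ 0 :=
    ge_of_tendsto (tendsto_const_div_atTop_nhds_zero_nat (g 1))
      (Filter.eventually_atTop.2 ⟨1, fun n hn => hbound n hn⟩)
  linarith [abs_nonpos_iff.1 hz]

theorem IsState.apply_scale [ConvexEffectAlgebra E] {ω : E → unitInterval} (hω : IsState ω)
    (r : unitInterval) (a : E) : (ω (scale r a) : ℝ) = r * ω a := by
  -- Clamping to `[0,1]` extends `r ↦ ω(ra)` to a function on ℝ; only its values on `[0,1]` are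
  -- used.
  let p : ℝ → unitInterval := Set.projIcc 0 1 zero_le_one
  have hp : ∀ x : ℝ, 0 ≤ x → x ≤ 1 → ((p x : unitInterval) : ℝ) = x := fun x h h' =>
    congrArg Subtype.val (Set.projIcc_of_mem zero_le_one ⟨h, h'⟩)
  have key := monotone_additive_linear (fun x => (ω (scale (p x) a) : ℝ))
    (fun x _ _ => (ω _).2.1) (by
      intro x y hx hy hxy
      obtain ⟨h, e⟩ := scale_add (p x) (p y) (p (x + y)) a
        (by rw [hp _ hx (by linarith), hp _ hy (by linarith), hp _ (by linarith) hxy])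
      simp only [e]
      exact hω.apply_oplus h) r.2.1 r.2.2
  have h1 : p 1 = 1 := Subtype.ext (hp 1 zero_le_one le_rfl)
  have hr : p r = r := Subtype.ext (hp r r.2.1 r.2.2)
  simpa only [h1, hr, scale_one] using key

end States

end EffectAlgebra

/-! ### Operators determined by expectations at unit vectors -/

section QuadraticForms

variable {H : Type u} [NormedAddCommGroup H] [InnerProductSpace ℂ H]

theorem inner_map_smul_self (T : H →L[ℂ] H) (z : ℂ) (x : H) :
    inner ℂ (T (z • x)) (z • x) = ((‖z‖ ^ 2 : ℝ) : ℂ) * inner ℂ (T x) x := by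
  rw [map_smul, inner_smul_left, inner_smul_right, ← mul_assoc, Complex.conj_mul']
  push_cast
  rfl

theorem exists_unit_vector_smul [Nontrivial H] (x : H) :
    ∃ φ : H, ‖φ‖ = 1 ∧ x = (‖x‖ : ℂ) • φ := by
  by_cases hx : x = 0
  · obtain ⟨φ, hφ⟩ := exists_norm_eq H zero_le_one
    exact ⟨φ, hφ, by simp [hx]⟩
  · have h : (‖x‖ : ℂ) ≠ 0 := by simpa using hx
    exact ⟨(‖x‖ : ℂ)⁻¹ • x, by simp [norm_smul, hx], by rw [smul_inv_smul₀ h]⟩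

theorem ext_inner_map_unit [Nontrivial H] {S T : H →L[ℂ] H}
    (h : ∀ φ : H, ‖φ‖ = 1 → inner ℂ (S φ) φ = inner ℂ (T φ) φ) : S = T := by
  refine ContinuousLinearMap.coe_inj.1 ((ext_inner_map _ _).1 fun x => ?_)
  obtain ⟨φ, hφ, e⟩ := exists_unit_vector_smul x
  change inner ℂ (S x) x = inner ℂ (T x) x
  rw [e, inner_map_smul_self, inner_map_smul_self, h φ hφ]

/-- Over ℂ a real-valued quadratic form forces symmetry, so self-adjointness need not be assumed. -/
theorem isPositive_of_unit [Nontrivial H] {T : H →L[ℂ] H}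
    (h : ∀ φ : H, ‖φ‖ = 1 → ∃ t : ℝ, 0 ≤ t ∧ inner ℂ (T φ) φ = t) : T.IsPositive := by
  refine (ContinuousLinearMap.isPositive_iff_complex T).2 fun x => ?_
  obtain ⟨φ, hφ, e⟩ := exists_unit_vector_smul x
  obtain ⟨t, ht, e'⟩ := h φ hφ
  have : inner ℂ (T x) x = ((‖(‖x‖ : ℂ)‖ ^ 2 * t : ℝ) : ℂ) := by
    conv_lhs => rw [e, inner_map_smul_self, e']
    push_cast
    rfl
  rw [this]
  exact ⟨rfl, by rw [RCLike.re_to_complex, Complex.ofReal_re]; positivity⟩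

theorem effect_of_unit [Nontrivial H] {T : H →L[ℂ] H}
    (h : ∀ φ : H, ‖φ‖ = 1 → ∃ t : unitInterval, inner ℂ (T φ) φ = (t : ℝ)) : 0 ≤ T ∧ T ≤ 1 := by
  constructor
  · refine (ContinuousLinearMap.nonneg_iff_isPositive T).2 (isPositive_of_unit fun φ hφ => ?_)
    obtain ⟨t, ht⟩ := h φ hφ
    exact ⟨t, t.2.1, ht⟩
  · refine (ContinuousLinearMap.le_def T 1).2 (isPositive_of_unit fun φ hφ => ?_)
    obtain ⟨t, ht⟩ := h φ hφ
    refine ⟨1 - t, sub_nonneg.2 t.2.2, ?_⟩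
    change inner ℂ (φ - T φ) φ = _
    rw [inner_sub_left, ht, inner_self_eq_norm_sq_to_K, hφ]
    simp

theorem inner_starProjection_singleton {v : H} (hv : ‖v‖ = 1) (x : H) :
    inner ℂ ((Submodule.span ℂ {v}).starProjection x) x = ((‖inner ℂ x v‖ ^ 2 : ℝ) : ℂ) := by
  rw [Submodule.starProjection_unit_singleton ℂ hv, inner_smul_left, Complex.conj_mul',
    norm_inner_symm]
  push_cast
  rfl

theorem starProjection_singleton_smul {z : ℂ} (hz : z ≠ 0) (v : H) :
    (Submodule.span ℂ {z • v}).starProjection = (Submodule.span ℂ {v}).starProjection := by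
  congr 1
  exact Submodule.span_singleton_smul_eq (IsUnit.mk0 z hz) v

/-- The spectral theorem for effects in finite dimension. -/
theorem HilbertEffect.exists_eq_sum_projections [FiniteDimensional ℂ H] (T : HilbertEffect H) :
    ∃ (n : ℕ) (v : Fin n → H) (t : Fin n → unitInterval), (∀ i, ‖v i‖ = 1) ∧
      T.1 = ∑ i, (((t i : unitInterval) : ℝ) : ℂ) •
        (Submodule.span ℂ {v i}).starProjection := by
  have hp : T.1.IsPositive := (ContinuousLinearMap.nonneg_iff_isPositive _).1 T.2.1
  have hq : (1 - T.1).IsPositive := (ContinuousLinearMap.le_def _ _).1 T.2.2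
  have hs : (T.1 : H →ₗ[ℂ] H).IsSymmetric := hp.isSymmetric
  let v := hs.eigenvectorBasis rfl
  let l := hs.eigenvalues rfl
  have hv : ∀ i, ‖v i‖ = 1 := fun i => v.orthonormal.1 i
  have hTv : ∀ i, T.1 (v i) = (l i : ℂ) • v i := fun i => hs.apply_eigenvectorBasis rfl i
  -- Each eigenvalue is an expectation of `T`, and both `T` and `1 - T` are positive.
  have hl : ∀ i, l i ∈ unitInterval := by
    intro i
    have h₁ := hp.re_inner_nonneg_left (v i)
    have h₂ := hq.re_inner_nonneg_left (v i)
    have e : inner ℂ (T.1 (v i)) (v i) = (l i : ℂ) := by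
      rw [hTv, inner_smul_left, inner_self_eq_norm_sq_to_K, hv]
      simp
    rw [sub_apply, inner_sub_left, e, one_apply_eq_self,
      inner_self_eq_norm_sq_to_K, hv] at h₂
    rw [e] at h₁
    constructor
    · simpa using h₁
    · simpa using h₂
  refine ⟨_, v, fun i => ⟨l i, hl i⟩, hv, ?_⟩
  refine ContinuousLinearMap.coe_inj.1 (v.toBasis.ext fun i => ?_)
  simp only [OrthonormalBasis.coe_toBasis, ContinuousLinearMap.coe_coe, sum_apply,
    smul_apply]
  rw [hTv, Finset.sum_eq_single i]
  · rw [Submodule.starProjection_unit_singleton ℂ (hv i), inner_self_eq_norm_sq_to_K, hv]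
    simp
  · intro j _ hj
    rw [Submodule.starProjection_unit_singleton ℂ (hv j), v.orthonormal.2 hj, zero_smul, smul_zero]
  · simp

end QuadraticForms

/-! ### The Hilbert space representation of effects -/

section Representation

variable {E : Type u} [ConvexEffectAlgebra E] {hat : E → E → unitInterval}
  {U : (A B : Context E) → StateSpace A ≃ₗᵢ[ℂ] StateSpace B}

theorem norm_stateVector (A : Context E) (a : {a : E // a ∈ A.carrier}) :
    ‖stateVector A a‖ = 1 := by
  classical
  simp [stateVector]

/-- The operator `∑ r_a P(U_AB â)`. -/
def contextOperator (U : (A B : Context E) → StateSpace A ≃ₗᵢ[ℂ] StateSpace B)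
    (B A : Context E) (r : E → unitInterval) : StateSpace B →L[ℂ] StateSpace B :=
  ∑ a : {a : E // a ∈ A.carrier}, (((r a.1 : unitInterval) : ℝ) : ℂ) •
    (Submodule.span ℂ {U A B (stateVector A a)}).starProjection

/-- Both sides equal `∑ r_a d̂(a)`: on the left by the transition rule, on the right because the
state `d̂` is additive and affine. -/
theorem inner_contextOperator_stateVector (hhat : IsStateChoice hat) (hU : IsComparison hat U)
    (B : Context E) {A : Context E} {r : E → unitInterval} {b : E}
    (h : IsSpectralDecomposition A r b) (D : Context E) (d : {d : E // d ∈ D.carrier}) :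
    inner ℂ (contextOperator U B A r (U D B (stateVector D d))) (U D B (stateVector D d)) =
      ((hat d.1 b : unitInterval) : ℝ) := by
  have hd := (hhat d.1 (D.oneDimensional _ d.2)).1
  rw [hd.apply_orthoSum h, ← Finset.sum_coe_sort, contextOperator,
    sum_apply, sum_inner, Complex.ofReal_sum]
  refine Finset.sum_congr rfl fun a _ => ?_
  rw [smul_apply, inner_smul_left, inner_starProjection_singleton,
    hU.transition, hd.apply_scale]
  · simp
  · rw [LinearIsometryEquiv.norm_map, norm_stateVector]

/-- Each unit vector of the state space gives a state whose values are the expectations of the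
operators of the spectral decompositions. -/
theorem exists_state (hhat : IsStateChoice hat) (hU : IsCompleteComparison hat U)
    (B : Context E) (φ : StateSpace B) (hφ : ‖φ‖ = 1) :
    ∃ ω : E → unitInterval, IsState ω ∧
      ∀ (A : Context E) (r : E → unitInterval) (b : E), IsSpectralDecomposition A r b →
        inner ℂ (contextOperator U B A r φ) φ = ((ω b : unitInterval) : ℝ) := by
  obtain ⟨D, d, z, hz, e⟩ := hU.complete B φ hφ
  refine ⟨hat d.1, (hhat d.1 (D.oneDimensional _ d.2)).1, fun A r b h => ?_⟩
  -- The phase `z` has modulus one and drops out of the quadratic form.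
  rw [← inner_contextOperator_stateVector hhat hU.toIsComparison B h D d, e, inner_map_smul_self,
    hz]
  simp

theorem contextOperator_eq (hhat : IsStateChoice hat) (hU : IsCompleteComparison hat U)
    (B : Context E) {A A' : Context E} {r r' : E → unitInterval} {b : E}
    (h : IsSpectralDecomposition A r b) (h' : IsSpectralDecomposition A' r' b) :
    contextOperator U B A r = contextOperator U B A' r' := by
  refine ext_inner_map_unit fun φ hφ => ?_
  obtain ⟨ω, -, hω⟩ := exists_state hhat hU B φ hφ
  rw [hω _ _ _ h, hω _ _ _ h']

theorem exists_hilbertRepresentation (hspectral : IsSpectral E) (hhat : IsStateChoice hat)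
    (hU : IsCompleteComparison hat U) (B : Context E) :
    ∃ J : E → HilbertEffect (StateSpace B), IsHilbertRepresentation U B J := by
  choose A r h using hspectral
  refine ⟨fun b => ⟨contextOperator U B (A b) (r b), effect_of_unit fun φ hφ => ?_⟩,
    fun A' r' b h' => contextOperator_eq hhat hU B (h b) h'⟩
  obtain ⟨ω, -, hω⟩ := exists_state hhat hU B φ hφ
  exact ⟨ω b, hω _ _ _ (h b)⟩

theorem IsHilbertRepresentation.unique (hspectral : IsSpectral E) {B : Context E}
    {J J' : E → HilbertEffect (StateSpace B)} (hJ : IsHilbertRepresentation U B J)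
    (hJ' : IsHilbertRepresentation U B J') : J = J' := by
  funext b
  obtain ⟨A, r, h⟩ := hspectral b
  exact Subtype.ext ((hJ A r b h).trans (hJ' A r b h).symm)

variable {B : Context E} {J : E → HilbertEffect (StateSpace B)}

theorem IsHilbertRepresentation.exists_state (hJ : IsHilbertRepresentation U B J)
    (hspectral : IsSpectral E) (hhat : IsStateChoice hat) (hU : IsCompleteComparison hat U)
    (φ : StateSpace B) (hφ : ‖φ‖ = 1) :
    ∃ ω : E → unitInterval, IsState ω ∧
      ∀ b : E, inner ℂ ((J b).1 φ) φ = ((ω b : unitInterval) : ℝ) := by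
  obtain ⟨ω, h, hω⟩ := _root_.exists_state hhat hU B φ hφ
  refine ⟨ω, h, fun b => ?_⟩
  obtain ⟨A, r, hb⟩ := hspectral b
  rw [hJ A r b hb]
  exact hω A r b hb

/-- The spectral decompositions of `a`, `b` and `a ⊕ b` may use unrelated contexts; comparing
expectations state by state avoids relating them. -/
theorem IsHilbertRepresentation.apply_oplus (hJ : IsHilbertRepresentation U B J)
    (hspectral : IsSpectral E) (hhat : IsStateChoice hat) (hU : IsCompleteComparison hat U)
    {a b : E} (h : perp a b) : (J (oplus a b h)).1 = (J a).1 + (J b).1 := by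
  refine ext_inner_map_unit fun φ hφ => ?_
  obtain ⟨ω, h', hω⟩ := hJ.exists_state hspectral hhat hU φ hφ
  rw [add_apply, inner_add_left, hω, hω, hω, h'.apply_oplus h]
  push_cast
  rfl

theorem IsHilbertRepresentation.apply_scale (hJ : IsHilbertRepresentation U B J)
    (hspectral : IsSpectral E) (hhat : IsStateChoice hat) (hU : IsCompleteComparison hat U)
    (t : unitInterval) (a : E) : (J (scale t a)).1 = ((t : ℝ) : ℂ) • (J a).1 := by
  refine ext_inner_map_unit fun φ hφ => ?_
  obtain ⟨ω, h', hω⟩ := hJ.exists_state hspectral hhat hU φ hφ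
  rw [smul_apply, inner_smul_left, hω, hω, h'.apply_scale]
  simp

theorem IsHilbertRepresentation.apply_one (hJ : IsHilbertRepresentation U B J)
    (hspectral : IsSpectral E) (hhat : IsStateChoice hat) (hU : IsCompleteComparison hat U) :
    (J one).1 = 1 := by
  refine ext_inner_map_unit fun φ hφ => ?_
  obtain ⟨ω, h', hω⟩ := hJ.exists_state hspectral hhat hU φ hφ
  rw [hω, h'.2, one_apply_eq_self, inner_self_eq_norm_sq_to_K, hφ]
  change (((1 : unitInterval) : ℝ) : ℂ) = _
  simp

theorem IsHilbertRepresentation.apply_of_mem (hJ : IsHilbertRepresentation U B J)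
    (A : Context E) (a : {a : E // a ∈ A.carrier}) :
    (J a.1).1 = (Submodule.span ℂ {U A B (stateVector A a)}).starProjection := by
  classical
  rw [hJ A _ _ (isSpectralDecomposition_single A a.2), Finset.sum_eq_single a]
  · simp
  · intro b _ hb
    simp [Subtype.coe_ne_coe.2 hb]
  · simp

/-- Unitarity of `U A B` keeps the basis vectors orthonormal, so only one term of the sum survives.
-/
theorem IsHilbertRepresentation.inner_apply_of_mem (hJ : IsHilbertRepresentation U B J)
    {A : Context E} {r : E → unitInterval} {b : E} (h : IsSpectralDecomposition A r b)
    (a : {a : E // a ∈ A.carrier}) :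
    inner ℂ ((J b).1 (U A B (stateVector A a))) (U A B (stateVector A a)) = (r a.1 : ℝ) := by
  classical
  have hn : ∀ c, ‖U A B (stateVector A c)‖ = 1 := fun c => by
    rw [LinearIsometryEquiv.norm_map, norm_stateVector]
  rw [hJ A r b h, sum_apply, sum_inner, Finset.sum_eq_single a]
  · rw [smul_apply, inner_smul_left, inner_starProjection_singleton (hn a),
      inner_self_eq_norm_sq_to_K, hn]
    simp
  · intro c _ hc
    rw [smul_apply, inner_smul_left, inner_starProjection_singleton (hn c),
      LinearIsometryEquiv.inner_map_map, stateVector, stateVector,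
      EuclideanSpace.inner_single_left]
    simp [hc.symm]
  · simp

theorem IsHilbertRepresentation.perp_of_perp (hJ : IsHilbertRepresentation U B J)
    (hspectral : IsSpectral E) (hhat : IsStateChoice hat) (hU : IsCompleteComparison hat U)
    {a b : E} (h : perp (J a) (J b)) : perp a b := by
  apply perp_of_perp_half
  obtain ⟨A, r, hc⟩ := hspectral (oplus _ _ (perp_half a b))
  -- With `ω` the state of the basis vector at `x`, the coefficient is `(ω a + ω b)/2`, and `J a + J
  -- b ≤ 1` bounds it by `1/2`.
  refine perp_self_of_le_half hc fun x hx => ?_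
  have e := hJ.inner_apply_of_mem hc ⟨x, hx⟩
  set φ := U A B (stateVector A ⟨x, hx⟩)
  have hφ : ‖φ‖ = 1 := by rw [LinearIsometryEquiv.norm_map, norm_stateVector]
  obtain ⟨ω, h', hω⟩ := hJ.exists_state hspectral hhat hU φ hφ
  have hp := ((ContinuousLinearMap.le_def _ _).1
    (h : (J a).1 + (J b).1 ≤ 1)).re_inner_nonneg_left φ
  rw [sub_apply, add_apply, inner_sub_left, inner_add_left,
    hω, hω, one_apply_eq_self, inner_self_eq_norm_sq_to_K, hφ] at hp
  rw [hω, h'.apply_oplus, h'.apply_scale, h'.apply_scale] at e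
  have e' := Complex.ofReal_injective e
  have hp' : (ω a : ℝ) + ω b ≤ 1 := by simpa using hp
  have hh : ((half : unitInterval) : ℝ) = 1 / 2 := rfl
  rw [hh] at e'
  linarith

/-- Completeness realizes every line of the spectral decomposition of `T` by a one-dimensional
effect. The scaled effects are added one at a time, which is possible because `J` reflects
orthogonality. -/
theorem IsHilbertRepresentation.surjective (hJ : IsHilbertRepresentation U B J)
    (hspectral : IsSpectral E) (hhat : IsStateChoice hat) (hU : IsCompleteComparison hat U) :
    Function.Surjective J := by
  classical
  intro T
  obtain ⟨n, v, t, hv, hT⟩ := T.exists_eq_sum_projections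
  have hproj : ∀ i, ∃ a : E, (J a).1 = (((t i : unitInterval) : ℝ) : ℂ) •
      (Submodule.span ℂ {v i}).starProjection := by
    intro i
    obtain ⟨A, a, z, hz, e⟩ := hU.complete B (v i) (hv i)
    refine ⟨scale (t i) a.1, ?_⟩
    rw [hJ.apply_scale hspectral hhat hU, hJ.apply_of_mem A a, e,
      starProjection_singleton_smul (norm_ne_zero_iff.1 (by rw [hz]; exact one_ne_zero))]
  choose f hf using hproj
  have hsum : ∀ s : Finset (Fin n), ∃ a : E, (J a).1 = ∑ i ∈ s, (J (f i)).1 := by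
    intro s
    induction s using Finset.induction_on with
    | empty =>
      exact ⟨scale 0 one, by rw [hJ.apply_scale hspectral hhat hU]; simp⟩
    | insert i s hi ih =>
      obtain ⟨a, ha⟩ := ih
      have h : perp (J (f i)) (J a) := by
        have hle : ∑ j ∈ insert i s, (J (f j)).1 ≤ 1 := by
          -- The omitted terms are positive, so a partial sum is at most `T ≤ 1`.
          refine le_trans (Finset.sum_le_univ_sum_of_nonneg fun j => (J (f j)).2.1) ?_
          simp only [hf]
          rw [← hT]
          exact T.2.2
        rw [Finset.sum_insert hi, ← ha] at hle
        exact hle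
      refine ⟨oplus _ _ (hJ.perp_of_perp hspectral hhat hU h), ?_⟩
      rw [hJ.apply_oplus hspectral hhat hU, ha, Finset.sum_insert hi]
  obtain ⟨a, ha⟩ := hsum Finset.univ
  refine ⟨a, Subtype.ext ?_⟩
  rw [ha, hT]
  simp only [hf]

theorem IsHilbertRepresentation.isAffineIsomorphism (hJ : IsHilbertRepresentation U B J)
    (hspectral : IsSpectral E) (hhat : IsStateChoice hat) (hU : IsCompleteComparison hat U) :
    IsAffineIsomorphism J := by
  refine ⟨⟨⟨⟨fun a b h => ?_, Subtype.ext (hJ.apply_one hspectral hhat hU)⟩,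
    fun a b h => hJ.perp_of_perp hspectral hhat hU h⟩, hJ.surjective hspectral hhat hU⟩,
    fun r a => Subtype.ext (hJ.apply_scale hspectral hhat hU r a)⟩
  have e := hJ.apply_oplus hspectral hhat hU h
  exact ⟨e.symm.le.trans (J (oplus a b h)).2.2, Subtype.ext e⟩

end Representation

/-! ### Injectivity of monomorphisms -/

namespace EffectAlgebra

variable {E : Type u} {F : Type v}

theorem IsMorphism.map_compl [EffectAlgebra E] [EffectAlgebra F] {φ : E → F} (hφ : IsMorphism φ)
    (a : E) : φ (compl a) = compl (φ a) := by
  obtain ⟨h, e⟩ := oplus_compl a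
  obtain ⟨h', e'⟩ := hφ.1 _ _ h
  exact compl_unique _ _ h' (by rw [← e', e, hφ.2])

theorem IsMorphism.map_zero [EffectAlgebra E] [EffectAlgebra F] {φ : E → F} (hφ : IsMorphism φ) :
    φ zero = zero := by
  rw [← compl_one, hφ.map_compl, hφ.2, compl_one]

/-- Reflecting orthogonality suffices. If `φ x = 1`, then `φ(x') = 0 ⊥ φ(1)`, so `x' ⊥ 1` and `x =
1`. If `φ a = φ b`, then `a ⊥ b'` and `a ⊕ b'` maps to `1`, hence equals `1`, and so `a = b`. -/
theorem IsMonomorphism.injective [EffectAlgebra E] [EffectAlgebra F] {φ : E → F}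
    (hφ : IsMonomorphism φ) : Function.Injective φ := by
  have hone : ∀ x : E, φ x = one → x = one := by
    intro x hx
    have h0 : compl x = zero := by
      refine eq_zero_of_perp_one _ (hφ.2 _ _ ?_)
      rw [hφ.1.map_compl, hx, compl_one, hφ.1.2]
      exact perp_symm (oplus_zero one).1
    rw [← compl_compl x, h0, ← compl_one, compl_compl]
  intro a b hab
  obtain ⟨h, e⟩ := oplus_compl (φ b)
  have h' : perp a (compl b) := by
    apply hφ.2
    rw [hφ.1.map_compl, hab]
    exact h
  obtain ⟨h'', e''⟩ := hφ.1.1 _ _ h'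
  have e₁ : oplus a (compl b) h' = one := by
    apply hone
    rw [e'', ← e]
    congr 1
    exact hφ.1.map_compl b
  obtain ⟨k, ek⟩ := oplus_comm _ _ h'
  rw [compl_unique _ _ k (ek.trans e₁), compl_compl]

end EffectAlgebra

/-! ### Transport of the sequential product -/

section Transport

variable {E : Type u} {F : Type v} [ConvexEffectAlgebra E] [ConvexEffectAlgebra F]
  {seq : E → E → E} {φ : E → F}

theorem IsAffineIsomorphism.injective (hφ : IsAffineIsomorphism φ) : Function.Injective φ :=
  hφ.1.1.injective

/-- Injectivity makes the prescribed values consistent; surjectivity leaves no other pair free. -/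
theorem IsAffineIsomorphism.existsUnique_prod (hφ : IsAffineIsomorphism φ) (seq : E → E → E) :
    ∃! prod : F → F → F, ∀ a b : E, prod (φ a) (φ b) = φ (seq a b) := by
  obtain ⟨ψ, hψ⟩ := hφ.1.2.hasRightInverse
  have hψ' : ∀ a, ψ (φ a) = a := fun a => hφ.injective (hψ (φ a))
  refine ⟨fun x y => φ (seq (ψ x) (ψ y)), fun a b => by simp only [hψ'], fun prod h => ?_⟩
  funext x y
  rw [← h, hψ, hψ]

/-- Sequential products are transported along affine isomorphisms. -/
theorem IsSequentialProduct.transport (hseq : IsSequentialProduct seq)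
    (hφ : IsAffineIsomorphism φ) {prod : F → F → F}
    (h : ∀ a b : E, prod (φ a) (φ b) = φ (seq a b)) : IsSequentialProduct prod := by
  have inj := hφ.injective
  have surj := hφ.1.2
  have hm := hφ.1.1.1
  -- The relation `a | b` is carried over in both directions, so the axioms (S3)–(S5) can be pulled
  -- back to `E`.
  have hcomm : ∀ a b : E, prod (φ a) (φ b) = prod (φ b) (φ a) ↔ seq a b = seq b a := by
    intro a b
    rw [h, h, inj.eq_iff]
  constructor
  · intro x y z hyz
    obtain ⟨a, rfl⟩ := surj x
    obtain ⟨b, rfl⟩ := surj y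
    obtain ⟨c, rfl⟩ := surj z
    have hbc := hφ.1.1.2 _ _ hyz
    obtain ⟨h₁, e₁⟩ := hm.1 _ _ hbc
    obtain ⟨h₂, e₂⟩ := hseq.additive a _ _ hbc
    obtain ⟨h₃, e₃⟩ := hm.1 _ _ h₂
    simp only [h]
    exact ⟨h₃, by rw [← e₁, h, e₂, e₃]⟩
  · intro x
    obtain ⟨a, rfl⟩ := surj x
    rw [← hm.2, h, hseq.one_seq]
  · intro x y e
    obtain ⟨a, rfl⟩ := surj x
    obtain ⟨b, rfl⟩ := surj y
    rw [h, ← hm.map_zero, inj.eq_iff] at e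
    exact (hcomm _ _).2 (hseq.comm_of_eq_zero _ _ e)
  · intro x y e
    obtain ⟨a, rfl⟩ := surj x
    obtain ⟨b, rfl⟩ := surj y
    rw [← hm.map_compl]
    exact (hcomm _ _).2 (hseq.comm_compl _ _ ((hcomm _ _).1 e))
  · intro x y e z
    obtain ⟨a, rfl⟩ := surj x
    obtain ⟨b, rfl⟩ := surj y
    obtain ⟨c, rfl⟩ := surj z
    simp only [h]
    rw [hseq.assoc _ _ ((hcomm _ _).1 e)]
  · intro x y z e₁ e₂
    obtain ⟨a, rfl⟩ := surj x
    obtain ⟨b, rfl⟩ := surj y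
    obtain ⟨c, rfl⟩ := surj z
    rw [h a b]
    exact (hcomm _ _).2 (hseq.comm_seq _ _ _ ((hcomm _ _).1 e₁) ((hcomm _ _).1 e₂))
  · intro x y z e₁ e₂ hxy
    obtain ⟨a, rfl⟩ := surj x
    obtain ⟨b, rfl⟩ := surj y
    obtain ⟨c, rfl⟩ := surj z
    -- Since `φ` reflects orthogonality, the sum in `F` is the image of a sum in `E`.
    obtain ⟨_, e⟩ := hm.1 _ _ (hφ.1.1.2 _ _ hxy)
    rw [← e]
    exact (hcomm _ _).2 (hseq.comm_oplus _ _ _ ((hcomm _ _).1 e₁) ((hcomm _ _).1 e₂) _)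
  · intro r x y
    obtain ⟨a, rfl⟩ := surj x
    obtain ⟨b, rfl⟩ := surj y
    rw [← hφ.2, h, h, hseq.scale_seq, hφ.2]
  · intro r x y
    obtain ⟨a, rfl⟩ := surj x
    obtain ⟨b, rfl⟩ := surj y
    rw [← hφ.2, h, h, hseq.seq_scale, hφ.2]

end Transport

end

theorem theorem4p6 {E : Type*} [ConvexEffectAlgebra E]
    (seq : E → E → E) (hseq : IsSequentialProduct seq)
    (hspectral : IsSpectral E)
    (hat : E → E → unitInterval) (hhat : IsStateChoice hat)
    (U : (A B : Context E) → StateSpace A ≃ₗᵢ[ℂ] StateSpace B)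
    (hU : IsCompleteComparison hat U)
    (B : Context E) :
    (∃! J : E → HilbertEffect (StateSpace B), IsHilbertRepresentation U B J) ∧
    ∀ J : E → HilbertEffect (StateSpace B), IsHilbertRepresentation U B J →
      IsAffineIsomorphism J ∧
      (∃! prod : HilbertEffect (StateSpace B) → HilbertEffect (StateSpace B) →
          HilbertEffect (StateSpace B), ∀ a b : E, prod (J a) (J b) = J (seq a b)) ∧
      ∀ prod : HilbertEffect (StateSpace B) → HilbertEffect (StateSpace B) →
          HilbertEffect (StateSpace B), (∀ a b : E, prod (J a) (J b) = J (seq a b)) →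
        IsSequentialProduct prod ∧ IsSEAIsomorphism seq prod J := by
  obtain ⟨J₀, hJ₀⟩ := exists_hilbertRepresentation hspectral hhat hU B
  refine ⟨⟨J₀, hJ₀, fun J hJ => hJ.unique hspectral hJ₀⟩, fun J hJ => ?_⟩
  have hiso := hJ.isAffineIsomorphism hspectral hhat hU
  exact ⟨hiso, hiso.existsUnique_prod seq, fun prod hprod =>
    ⟨hseq.transport hiso hprod, hiso, fun a b => (hprod a b).symm⟩⟩
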